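/- Let $\Sigma=\{a,b\}$. For a word $w\in\Sigma^*$ and $0\le k\le |w|$, let $P_a(w,k)$ be the number of occurrences of the letter $a$ in the prefix of $w$ of length $k$, and let $F_a(w,k)$ be the maximum number of occurrences of $a$ in a factor (contiguous subword) of $w$ of length $k$. A word $w\in\Sigma^*$ is called prefix normal (with respect to $a$) if $F_a(w,k)=P_a(w,k)$ for every $0\le k\le |w|$. Then the language $L_a\subset\Sigma^*$ of all prefix normal words is not context-free. -/

import Mathlib

/-- The binary alphabet `Σ = {a, b}`. -/
inductive Letter where
  | a : Letter
  | b : Letter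
  deriving DecidableEq

/-- `P x w k` is the number of occurrences of the letter `x` in the prefix of length `k` of `w`. -/
def P (x : Letter) (w : List Letter) (k : ℕ) : ℕ :=
  (w.take k).count x

/-- The set of all numbers `|v|_x` where `v` runs through the factors of `w` of length `k`
(`v <:+: w` says that `v` is a factor, i.e. a contiguous subword, of `w`). -/
def factorCounts (x : Letter) (w : List Letter) (k : ℕ) : Set ℕ :=
  {m | ∃ v : List Letter, v <:+: w ∧ v.length = k ∧ v.count x = m}

/-- `F x w k` is the maximum number of occurrences of the letter `x` in a factor of `w` of
length `k`, for `0 ≤ k ≤ |w|`. -/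
noncomputable def F (x : Letter) (w : List Letter) (k : ℕ) : ℕ :=
  sSup (factorCounts x w k)

/-- For `k ≤ |w|` the supremum in the definition of `F` is an attained maximum. -/
theorem F_isGreatest (x : Letter) (w : List Letter) (k : ℕ) (hk : k ≤ w.length) :
    IsGreatest (factorCounts x w k) (F x w k) := by
  have hne : (factorCounts x w k).Nonempty :=
    ⟨_, w.take k, (List.take_prefix k w).isInfix, by simp [hk], rfl⟩
  have hbdd : BddAbove (factorCounts x w k) := by
    refine ⟨k, ?_⟩
    rintro m ⟨v, -, hv, rfl⟩
    exact hv ▸ List.count_le_length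
  exact ⟨Nat.sSup_mem hne hbdd, fun m hm => le_csSup hbdd hm⟩

/-- A word `w` over `{a, b}` is prefix normal (with respect to the letter `a`) if
`F_a(w, k) = P_a(w, k)` for every `0 ≤ k ≤ |w|`. -/
def IsPrefixNormal (w : List Letter) : Prop :=
  ∀ k : ℕ, k ≤ w.length → F Letter.a w k = P Letter.a w k

/-- The language `L_a` of prefix normal words. -/
def prefixNormalLanguage : Language Letter :=
  {w | IsPrefixNormal w}

/-! Interchanging factors between the prefix normal words `a^N b a^N b a^N` of different sizes
destroys prefix normality. In a prefix normal word a run `a^t` anywhere forces the prefix `a^t`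
(`IsPrefixNormal.getElem?_eq_a`), so it suffices to create an early `b` and a longer run of `a`
elsewhere. For a context-free language, `Language.IsContextFree.interchange` gives each such word a
factor `x` of length in `(n + 1, N]`, too short to contain both `b`s, with only finitely many
exchange types. By pigeonhole, infinitely many words share a type. Exchanging a factor with a much
longer one of the same type breaks one of the two resulting words, wherever the factors lie relative
to the first `b`. -/

namespace ContextFreeGrammar

/-! ### Parse forests of a context-free grammar -/

variable {T : Type*}

/-- Big-step semantics of a context-free grammar: `g.Yields s w` says that the word `w` is the
frontier of a parse forest of `g` with roots `s`. -/
inductive Yields (g : ContextFreeGrammar T) : List (Symbol T g.NT) → List T → Prop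
  | nil : Yields g [] []
  | terminal (t : T) {s : List (Symbol T g.NT)} {w : List T} :
      Yields g s w → Yields g (.terminal t :: s) (t :: w)
  | nonterminal {r : ContextFreeRule T g.NT} {s : List (Symbol T g.NT)} {v w : List T} :
      r ∈ g.rules → Yields g r.output v → Yields g s w →
      Yields g (.nonterminal r.input :: s) (v ++ w)

variable {g : ContextFreeGrammar T}

theorem Yields.derives {s : List (Symbol T g.NT)} {w : List T} (h : g.Yields s w) :
    g.Derives s (w.map .terminal) := by
  induction h with
  | nil => exact Derives.refl _
  | terminal t _ ih => exact ih.append_left [.terminal t]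
  | @nonterminal r s v w hr _ _ ihv ihw =>
    have hstep : g.Produces [.nonterminal r.input] r.output :=
      ⟨r, hr, ContextFreeRule.Rewrites.input_output⟩
    rw [List.map_append]
    exact ((hstep.trans_derives ihv).append_right s).trans (ihw.append_left _)

theorem Yields.exists_of_append {s₁ s₂ : List (Symbol T g.NT)} {w : List T}
    (h : g.Yields (s₁ ++ s₂) w) :
    ∃ w₁ w₂, w = w₁ ++ w₂ ∧ g.Yields s₁ w₁ ∧ g.Yields s₂ w₂ := by
  induction s₁ generalizing w with
  | nil => exact ⟨[], w, rfl, .nil, h⟩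
  | cons c s₁ ih =>
    cases h with
    | terminal t h =>
      obtain ⟨w₁, w₂, rfl, h₁, h₂⟩ := ih h
      exact ⟨t :: w₁, w₂, rfl, .terminal t h₁, h₂⟩
    | @nonterminal r _ v _ hr hv h =>
      obtain ⟨w₁, w₂, rfl, h₁, h₂⟩ := ih h
      exact ⟨v ++ w₁, w₂, by simp, .nonterminal hr hv h₁, h₂⟩

theorem yields_map_terminal (w : List T) : g.Yields (w.map .terminal) w := by
  induction w with
  | nil => exact .nil
  | cons t w ih => exact .terminal t ih

/-- Undoing a rewrite step gathers the trees over the right-hand side under a new node; this is the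
inductive step that turns derivations into parse forests. -/
theorem Yields.of_rewrites {r : ContextFreeRule T g.NT} (hr : r ∈ g.rules)
    {s₁ s₂ : List (Symbol T g.NT)} (h : r.Rewrites s₁ s₂) {w : List T} (hw : g.Yields s₂ w) :
    g.Yields s₁ w := by
  induction h generalizing w with
  | head s =>
    obtain ⟨w₁, w₂, rfl, h₁, h₂⟩ := hw.exists_of_append
    exact .nonterminal hr h₁ h₂
  | cons x _ ih =>
    cases hw with
    | terminal t h => exact .terminal t (ih h)
    | nonterminal hr' hv h => exact .nonterminal hr' hv (ih h)

theorem Derives.yields {s : List (Symbol T g.NT)} {w : List T}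
    (h : g.Derives s (w.map .terminal)) : g.Yields s w := by
  induction h using Relation.ReflTransGen.head_induction_on with
  | refl => exact yields_map_terminal w
  | head hstep _ ih =>
    obtain ⟨r, hr, hrw⟩ := hstep
    exact ih.of_rewrites hr hrw

/-- A parse forest with a long frontier has a node whose frontier has length in `(M, K * M]`,
where `K` bounds the lengths of the right-hand sides of the rules. -/
theorem Yields.exists_subtree {K M : ℕ} (hK : ∀ r ∈ g.rules, r.output.length ≤ K) (hM : 1 ≤ M)
    {s : List (Symbol T g.NT)} {w : List T} (h : g.Yields s w) (hlen : M * s.length < w.length) :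
    ∃ r ∈ g.rules, ∃ u x z : List T, w = u ++ x ++ z ∧
      g.Derives s (u.map .terminal ++ [.nonterminal r.input] ++ z.map .terminal) ∧
      g.Derives [.nonterminal r.input] (x.map .terminal) ∧
      M < x.length ∧ x.length ≤ K * M := by
  induction h with
  | nil => simp at hlen
  | @terminal t s w _ ih =>
    simp only [List.length_cons, mul_add, mul_one] at hlen
    -- Dropping a terminal costs one letter, while the bound drops by `M ≥ 1`.
    obtain ⟨r, hr, u, x, z, rfl, hs, hx, h₁, h₂⟩ := ih (by omega)
    exact ⟨r, hr, t :: u, x, z, by simp, by simpa using hs.append_left [.terminal t], hx, h₁, h₂⟩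
  | @nonterminal r s v w hr hv hw ihv ihw =>
    have hstep : g.Produces [.nonterminal r.input] r.output :=
      ⟨r, hr, ContextFreeRule.Rewrites.input_output⟩
    simp only [List.length_cons, List.length_append, mul_add, mul_one] at hlen
    by_cases hMv : M < v.length
    · by_cases hvK : v.length ≤ K * M
      · exact ⟨r, hr, [], v, w, by simp, by simpa using hw.derives.append_left [_],
          hstep.trans_derives hv.derives, hMv, hvK⟩
      -- The frontier of this root is longer than `K * M` and it has at most `K` children, so the
      -- induction hypothesis applies to them.
      · have hle : M * r.output.length ≤ K * M := by
          rw [mul_comm K]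
          exact Nat.mul_le_mul_left M (hK r hr)
        obtain ⟨r', hr', u, x, z, rfl, hs, hx, h₁, h₂⟩ := ihv (by omega)
        refine ⟨r', hr', u, x, z ++ w, by simp, ?_, hx, h₁, h₂⟩
        have := ((hstep.trans_derives hs).append_right s).trans (hw.derives.append_left _)
        simpa using this
    · obtain ⟨r', hr', u, x, z, rfl, hs, hx, h₁, h₂⟩ := ihw (by omega)
      refine ⟨r', hr', v ++ u, x, z, by simp, ?_, hx, h₁, h₂⟩
      have := ((hstep.trans_derives hv.derives).append_right s).trans (hs.append_left _)
      simpa using this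

end ContextFreeGrammar

/-- Interchange lemma for context-free languages: every long word of `L` has a factor of length in
`(M, K * M]`, of one of finitely many types `i : ι`, such that factors of the same type can be
exchanged between words of `L`. Here `E i` holds for the factors of type `i` and `C i` for
their contexts. -/
theorem Language.IsContextFree.interchange.{u} {T : Type u} {L : Language T} (hL : L.IsContextFree) :
    ∃ (K : ℕ) (ι : Type u) (_ : Finite ι) (C : ι → List T → List T → Prop) (E : ι → List T → Prop),
      (∀ i u x z, C i u z → E i x → u ++ x ++ z ∈ L) ∧
      ∀ M, 1 ≤ M → ∀ w ∈ L, M < w.length →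
        ∃ i u x z, w = u ++ x ++ z ∧ C i u z ∧ E i x ∧ M < x.length ∧ x.length ≤ K * M := by
  obtain ⟨g, rfl⟩ := hL
  refine ⟨g.rules.sup fun r => r.output.length, {r // r ∈ g.rules}, inferInstance,
    fun r u z => g.Derives [.nonterminal g.initial]
      (u.map .terminal ++ [.nonterminal r.1.input] ++ z.map .terminal),
    fun r x => g.Derives [.nonterminal r.1.input] (x.map .terminal), ?_, ?_⟩
  · intro i u x z hC hE
    rw [ContextFreeGrammar.mem_language_iff, List.map_append, List.map_append]
    exact hC.trans ((hE.append_left _).append_right _)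
  · intro M hM w hw hlen
    obtain ⟨r, hr, u, x, z, h⟩ := ContextFreeGrammar.Yields.exists_subtree
      (K := g.rules.sup fun r => r.output.length)
      (fun r hr => Finset.le_sup (f := fun r => r.output.length) hr) hM
      (ContextFreeGrammar.Derives.yields hw) (by simpa using hlen)
    exact ⟨⟨r, hr⟩, u, x, z, h⟩

/-! ### Prefix normality and the test words -/

/-- In a prefix normal word, a factor `a ^ t` at some position forces the prefix `a ^ t`. -/
theorem IsPrefixNormal.getElem?_eq_a {w : List Letter} (hw : IsPrefixNormal w) {j t : ℕ}
    (hrun : ∀ i < t, w[j + i]? = some Letter.a) : ∀ i < t, w[i]? = some Letter.a := by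
  have hfac : (w.drop j).take t = List.replicate t Letter.a := by
    apply List.ext_getElem?
    intro i
    by_cases hi : i < t
    · simp [hi, hrun]
    · simp [hi]
  have hinf : List.replicate t Letter.a <:+: w :=
    hfac ▸ ((List.take_prefix t _).isInfix.trans (List.drop_suffix j w).isInfix)
  have ht : t ≤ w.length := by simpa using hinf.length_le
  have hcount : t ≤ (w.take t).count Letter.a := by
    have h := (F_isGreatest Letter.a w t ht).2 ⟨_, hinf, List.length_replicate, List.count_replicate_self⟩
    rw [hw t ht] at h
    simpa [P] using h
  have hpre : w.take t = List.replicate t Letter.a := by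
    have hlen : (w.take t).length = t := by simpa using ht
    rw [List.eq_replicate_iff]
    refine ⟨hlen, fun c hc => ?_⟩
    have := List.count_eq_length.1 (le_antisymm List.count_le_length (by rw [hlen]; exact hcount))
    exact (this c hc).symm
  intro i hi
  have := congrArg (·[i]?) hpre
  simpa [List.getElem?_take, hi] using this

/-- The word `a ^ n b a ^ n b a ^ n`. -/
def threeBlocks (n : ℕ) : List Letter :=
  List.replicate n Letter.a ++ (List.replicate 1 Letter.b ++ (List.replicate n Letter.a ++
    (List.replicate 1 Letter.b ++ List.replicate n Letter.a)))

theorem length_threeBlocks (n : ℕ) : (threeBlocks n).length = 3 * n + 2 := by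
  simp [threeBlocks]
  omega

theorem getElem?_threeBlocks (n k : ℕ) : (threeBlocks n)[k]? =
    if k = n ∨ k = 2 * n + 1 then some Letter.b
    else if k < 3 * n + 2 then some Letter.a else none := by
  simp only [threeBlocks, List.getElem?_append, List.getElem?_replicate, List.length_replicate]
  split_ifs <;> first | rfl | omega

/-- Every factor of length greater than `n` contains a `b`, and every factor of length greater than
`2 * n + 1` contains both; the prefix never contains more than these forced ones. -/
theorem isPrefixNormal_threeBlocks (n : ℕ) : IsPrefixNormal (threeBlocks n) := by
  intro k hk
  have hF := F_isGreatest Letter.a _ k hk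
  refine le_antisymm ?_
    (hF.2 ⟨_, (List.take_prefix k _).isInfix, by simpa using hk, rfl⟩)
  obtain ⟨v, ⟨s, t, hst⟩, hvk, hv⟩ := hF.1
  have hv' : v = ((threeBlocks n).drop s.length).take k := by
    rw [← hst, ← hvk]
    simp
  have hlen : s.length + k ≤ 3 * n + 2 := by
    rw [← length_threeBlocks, ← hst, ← hvk]
    simp
  rw [← hv, hv', P]
  simp only [threeBlocks, List.drop_append, List.take_append, List.drop_replicate,
    List.take_replicate, List.count_append, List.count_replicate, List.length_replicate]
  simp
  omega

theorem getElem?_interchange {α : Type*} {u x z u' x' z' w w' : List α}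
    (h : w = u ++ x ++ z) (h' : w' = u' ++ x' ++ z') (k : ℕ) :
    (u ++ x' ++ z)[k]? =
      if k < u.length then w[k]?
      else if k < u.length + x'.length then w'[k - u.length + u'.length]?
      else w[k - x'.length + x.length]? := by
  subst h h'
  simp only [List.getElem?_append, List.length_append]
  split_ifs <;> first | rfl | omega | (congr 1; omega)

theorem theorem3 : ¬ prefixNormalLanguage.IsContextFree := by
  intro hL
  obtain ⟨K, ι, hι, C, E, hCE, hdec⟩ := hL.interchange
  -- Blocks of length `max K 1 * (n + 1)` are at least as long as the factor, which therefore meets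
  -- at most one `b`; the `max` keeps the word long enough when `K = 0`.
  have hword (n : ℕ) := hdec (n + 1) (by omega) (threeBlocks (max K 1 * (n + 1)))
    (isPrefixNormal_threeBlocks _) (by
      rw [length_threeBlocks]
      have : 1 * (n + 1) ≤ max K 1 * (n + 1) := Nat.mul_le_mul_right _ (le_max_right _ _)
      omega)
  choose i u x z hw hC hE hlow hup using hword
  have hup' (n : ℕ) : (x n).length ≤ max K 1 * (n + 1) :=
    (hup n).trans (Nat.mul_le_mul_right _ (le_max_left _ _))
  generalize hN : (fun n : ℕ => max K 1 * (n + 1)) = N at *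
  have hN' (n : ℕ) : max K 1 * (n + 1) = N n := congrFun hN n
  simp only [hN'] at hw hup'
  -- The position of the factor relative to the first `b` is made part of its type.
  obtain ⟨c, hc⟩ := Finite.exists_infinite_fiber
    (fun n => (i n, decide (N n < (u n).length + (x n).length)))
  have hlarge (B : ℕ) := (Set.infinite_coe_iff.1 hc).exists_gt B
  have htype {n m : ℕ} (hn : (i n, decide (N n < (u n).length + (x n).length)) = c)
      (hm : (i m, decide (N m < (u m).length + (x m).length)) = c) : i n = i m ∧
      (N n < (u n).length + (x n).length ↔ N m < (u m).length + (x m).length) := by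
    have := hn.trans hm.symm
    simpa using this
  have hmem {n m : ℕ} (h : i n = i m) : IsPrefixNormal (u n ++ x m ++ z n) :=
    hCE (i n) _ _ _ (hC n) (h ▸ hE m)
  have hlen (n : ℕ) : (u n).length + (x n).length ≤ 3 * N n + 2 := by
    rw [← length_threeBlocks, hw n]
    simp
  have hget (n m k : ℕ) := getElem?_interchange (hw n) (hw m) k
  simp only [getElem?_threeBlocks] at hget
  have hrun {n m : ℕ} (h : i n = i m) (j t k : ℕ) (hk : k < t)
      (hb : (u n ++ x m ++ z n)[k]? = some Letter.b)
      (ha : ∀ l < t, (u n ++ x m ++ z n)[j + l]? = some Letter.a) : False := by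
    have := (hmem h).getElem?_eq_a ha k hk
    rw [hb] at this
    cases this
  -- If the first `b` lay in `u n`, it would stay at position `N n` when a huge `x m` is inserted,
  -- and `x m` contains a run of `N n + 1` letters `a`.
  have hfirst {n : ℕ} (hn : (i n, decide (N n < (u n).length + (x n).length)) = c) :
      (u n).length ≤ N n := by
    by_contra! hlt
    obtain ⟨m, hm, hnm⟩ := hlarge (2 * N n + 4)
    have hi := (htype hn hm).1
    have := hlen n
    have := hlen m
    have := hlow m
    have := hup' m
    have hb : (u n ++ x m ++ z n)[N n]? = some Letter.b := by
      rw [hget]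
      split_ifs <;> first | rfl | omega
    -- As `x m` has at most one `b` and more than `2 * N n + 4` letters, its first or its last `N n
    -- + 1` letters are all `a`.
    by_cases hstart : ∀ l < N n + 1, (u m).length + l ≠ N m ∧ (u m).length + l ≠ 2 * N m + 1
    · refine hrun hi (u n).length (N n + 1) (N n) (by omega) hb fun l hl => ?_
      have := hstart l hl
      rw [hget]
      split_ifs <;> first | rfl | omega
    · push Not at hstart
      obtain ⟨l₀, hl₀, hl₀'⟩ := hstart
      refine hrun hi ((u n).length + (x m).length - (N n + 1)) (N n + 1) (N n) (by omega) hb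
        fun l hl => ?_
      rw [hget]
      split_ifs <;> first | rfl | omega
  obtain ⟨n, hn, -⟩ := hlarge 0
  obtain ⟨m, hm, hnm⟩ := hlarge (4 * N n + 4)
  obtain ⟨hi, hiff⟩ := htype hn hm
  have hun := hfirst hn
  have hum := hfirst hm
  have := hlen n
  have := hlen m
  have := hlow m
  have := hlow n
  have := hup' m
  have := hup' n
  -- The last block of the large word lies in `z m` and survives the exchange, so any `b` before
  -- position `N m` is a contradiction.
  have hmn : ∀ l < N m, (u m ++ x n ++ z m)[2 * N m + 2 - (x m).length + (x n).length + l]? =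
      some Letter.a := by
    intro l hl
    rw [hget]
    split_ifs <;> first | rfl | omega
  by_cases hx : N n < (u n).length + (x n).length
  · have hx' := hiff.1 hx
    -- Both factors contain the first `b`. If at most `N n` letters precede it in `x m`, then in the
    -- small context it sits at position at most `2 * N n`, followed by a run of `2 * N n + 1`
    -- letters `a`. Otherwise, putting `x n` into the large context moves the first `b` to the left
    -- of position `N m`.
    by_cases hshort : N m ≤ (u m).length + N n
    · refine hrun hi ((u n).length + (N m - (u m).length) + 1) (2 * N n + 1)
        ((u n).length + (N m - (u m).length)) (by omega) ?_ fun l hl => ?_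
      all_goals
        rw [hget]
        split_ifs <;> first | rfl | omega
    · refine hrun hi.symm _ (N m) ((u m).length + (N n - (u n).length)) (by omega) ?_ hmn
      rw [hget]
      split_ifs <;> first | rfl | omega
  -- Both factors lie before the first `b`, so replacing `x m` by the shorter `x n` moves that `b`
  -- to the left.
  · have hx' := mt hiff.2 hx
    refine hrun hi.symm _ (N m) (N m - (x m).length + (x n).length) (by omega) ?_ hmn
    rw [hget]
    split_ifs <;> first | rfl | omega
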